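/- Let $m\ge 0$ and let $RC_m=\mathbb Z_2\langle g_1\rangle\ast\cdots\ast\mathbb Z_2\langle g_m\rangle$ be the free product of $m$ copies of the group of order two with generators $g_1,\dots,g_m$; that is, $RC_m$ is the right-angled Coxeter group $$RC_{\mathcal K}=F(g_1,\dots,g_m)/(g_i^2=1\ (1\le i\le m),\; g_ig_j=g_jg_i\ \text{for}\ \{i,j\}\in\mathcal K)$$ of the simplicial complex $\mathcal K$ on $\{1,\dots,m\}$ consisting of $m$ disjoint points. For a group $G$ put $(a,b)=a^{-1}b^{-1}ab$, $\gamma_1(G)=G$, $\gamma_{k+1}(G)=(\gamma_k(G),G)$ and $L^k(G)=\gamma_k(G)/\gamma_{k+1}(G)$, an abelian group written additively. Write $\overline a\in L^k(G)$ for the class of $a\in\gamma_k(G)$. The Lie bracket $L^k(G)\times L^l(G)\to L^{k+l}(G)$ is given by $[\overline a,\overline b]=\overline{(a,b)}$, and $[x,y,z]:=[[x,y],z]$. For $G=RC_{\mathcal K}$ every $L^k(G)$ is annihilated by $2$, so it is a vector space over the field $\mathbb Z_2$ of two elements. Then, over $\mathbb Z_2$: (a) $L^1(RC_m)$ has a basis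 $\overline g_1,\dots,\overline g_m$; (b) $L^2(RC_m)$ has a basis consisting of the commutators $[\overline g_i,\overline g_j]$ with $1\le i<j\le m$; (c) $L^3(RC_m)$ has a basis consisting of the commutators $[\overline g_i,\overline g_j,\overline g_j]$ with $1\le i<j\le m$ together with the commutators $[\overline g_i,\overline g_j,\overline g_k]$ with $1\le i,j,k\le m$, $i<j$, $k<j$ and $i\ne k$. -/

import Mathlib

open scoped commutatorElement

/-! ### The right-angled Coxeter group of a simplicial complex -/

/-- The defining relators of the right-angled Coxeter group: `gᵢ²` for every `i`, and the relations
`gᵢ gⱼ = gⱼ gᵢ` for `{i, j} ∈ K`. (In `AbstractSimplicialComplex` all singletons are faces, and the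
empty simplex is left implicit.) -/
def racgRels {m : ℕ} (K : AbstractSimplicialComplex (Fin m)) : Set (FreeGroup (Fin m)) :=
  {r | ∃ i, r = FreeGroup.of i ^ 2} ∪
    {r | ∃ i j, ({i, j} : Finset (Fin m)) ∈ K ∧
      r = (FreeGroup.of i * FreeGroup.of j) * (FreeGroup.of j * FreeGroup.of i)⁻¹}

/-- The right-angled Coxeter group of a simplicial complex on the vertices `0, …, m - 1`. -/
def RACG {m : ℕ} (K : AbstractSimplicialComplex (Fin m)) : Type :=
  PresentedGroup (racgRels K)

instance RACG.instGroup {m : ℕ} (K : AbstractSimplicialComplex (Fin m)) : Group (RACG K) :=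
  inferInstanceAs (Group (PresentedGroup (racgRels K)))

/-- The generator `gᵢ`. -/
def RACG.gen {m : ℕ} (K : AbstractSimplicialComplex (Fin m)) (i : Fin m) : RACG K :=
  PresentedGroup.of (rels := racgRels K) i

theorem RACG.gen_sq {m : ℕ} (K : AbstractSimplicialComplex (Fin m)) (i : Fin m) :
    RACG.gen K i * RACG.gen K i = 1 := by
  have h : PresentedGroup.mk (racgRels K) (FreeGroup.of i ^ 2) = 1 :=
    PresentedGroup.one_of_mem (Or.inl ⟨i, rfl⟩)
  rw [pow_two, map_mul] at h
  exact h

theorem RACG.closure_gen {m : ℕ} (K : AbstractSimplicialComplex (Fin m)) :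
    Subgroup.closure (Set.range (RACG.gen K)) = ⊤ :=
  PresentedGroup.closure_range_of (racgRels K)

/-! ### The lower central series and the associated graded Lie ring of a group -/

section Graded

variable (G : Type*) [Group G]

/-- The lower central series with the indexing `γ₁ = G`, `γₖ₊₁ = (γₖ, G)`. (Mathlib's series starts
at `0`; the value at `k = 0` is `G` as well, so that the graded piece `L⁰` is trivial.) -/
def lcs (k : ℕ) : Subgroup G :=
  (⊤ : Subgroup G).lowerCentralSeries (k - 1)

instance lcs_normal (k : ℕ) : (lcs G k).Normal := by
  unfold lcs; infer_instance

theorem lcs_zero : lcs G 0 = ⊤ := rfl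

theorem lcs_one : lcs G 1 = ⊤ := rfl

theorem lcs_succ_succ (k : ℕ) : lcs G (k + 2) = ⁅lcs G (k + 1), (⊤ : Subgroup G)⁆ := rfl

theorem lcs_antitone : Antitone (lcs G) := fun _ _ h =>
  Subgroup.lowerCentralSeries_antitone ⊤ (Nat.sub_le_sub_right h 1)

theorem commutator_top_le_lcs (k : ℕ) : ⁅lcs G k, (⊤ : Subgroup G)⁆ ≤ lcs G (k + 1) := by
  cases k with
  | zero => exact le_top
  | succ k => exact (lcs_succ_succ G k).ge

variable {G} in
theorem three_subgroups (A B C N : Subgroup G) [N.Normal]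
    (h1 : ⁅⁅B, C⁆, A⁆ ≤ N) (h2 : ⁅⁅C, A⁆, B⁆ ≤ N) : ⁅⁅A, B⁆, C⁆ ≤ N := by
  have key : ∀ X Y Z : Subgroup G, ⁅⁅X, Y⁆, Z⁆ ≤ N ↔
      ⁅⁅X.map (QuotientGroup.mk' N), Y.map (QuotientGroup.mk' N)⁆,
        Z.map (QuotientGroup.mk' N)⁆ = ⊥ := fun X Y Z => by
    rw [← Subgroup.map_commutator, ← Subgroup.map_commutator, Subgroup.map_eq_bot_iff,
      QuotientGroup.ker_mk']
  rw [key] at *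
  exact Subgroup.commutator_commutator_eq_bot_of_rotate h1 h2

theorem commutator_lcs_le (k l : ℕ) : ⁅lcs G k, lcs G l⁆ ≤ lcs G (k + l) := by
  induction l generalizing k with
  | zero => exact Subgroup.commutator_le_left _ _
  | succ l ih =>
    cases l with
    | zero => exact commutator_top_le_lcs G k
    | succ l =>
      rw [lcs_succ_succ, Subgroup.commutator_comm]
      apply three_subgroups
      · rw [Subgroup.commutator_comm ⊤]
        refine (Subgroup.commutator_mono (commutator_top_le_lcs G k) le_rfl).trans ?_
        refine (ih (k + 1)).trans (lcs_antitone G (by omega))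
      · refine (Subgroup.commutator_mono (ih k) le_rfl).trans ?_
        exact (commutator_top_le_lcs G _).trans (lcs_antitone G (by omega))

/-- The commutator `(a, b) = a⁻¹ b⁻¹ a b`. -/
def gcomm {G : Type*} [Group G] (a b : G) : G := a⁻¹ * b⁻¹ * a * b

variable {G}

theorem gcomm_eq (a b : G) : gcomm a b = ⁅a⁻¹, b⁻¹⁆ := by
  simp [gcomm, commutatorElement_def]

theorem gcomm_mem_lcs {k l : ℕ} {a b : G} (ha : a ∈ lcs G k) (hb : b ∈ lcs G l) :
    gcomm a b ∈ lcs G (k + l) := by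
  rw [gcomm_eq]
  exact commutator_lcs_le G k l
    (Subgroup.commutator_mem_commutator (inv_mem ha) (inv_mem hb))

variable (G) in
/-- The group `γₖ / γₖ₊₁`, written multiplicatively. -/
abbrev LcsQuot (k : ℕ) : Type _ := lcs G k ⧸ (lcs G (k + 1)).subgroupOf (lcs G k)

theorem lcsQuot_mk_eq_iff {k : ℕ} (a b : lcs G k) :
    (a : LcsQuot G k) = (b : LcsQuot G k) ↔ (a : G)⁻¹ * b ∈ lcs G (k + 1) := by
  rw [QuotientGroup.eq, Subgroup.mem_subgroupOf]
  rfl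

instance lcsQuotCommGroup (k : ℕ) : CommGroup (LcsQuot G k) :=
  { (inferInstance : Group (LcsQuot G k)) with
    mul_comm := by
      intro x y
      induction x using QuotientGroup.induction_on with | H a => ?_
      induction y using QuotientGroup.induction_on with | H b => ?_
      rw [← QuotientGroup.mk_mul, ← QuotientGroup.mk_mul, lcsQuot_mk_eq_iff]
      have h := commutator_top_le_lcs G k (Subgroup.commutator_mem_commutator
        (inv_mem b.2) (Subgroup.mem_top (a : G)⁻¹))
      convert h using 1
      simp [commutatorElement_def, mul_assoc] }

/-- The commutator `(a, b)` of `a ∈ γₖ` and `b ∈ γₗ`, as an element of `γₖ₊ₗ`. -/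
def lcsComm {k l : ℕ} (a : lcs G k) (b : lcs G l) : lcs G (k + l) :=
  ⟨gcomm (a : G) b, gcomm_mem_lcs a.2 b.2⟩

theorem lcsComm_mul_left {k l : ℕ} (a a' : lcs G k) (b : lcs G l) :
    (lcsComm (a * a') b : LcsQuot G (k + l)) = lcsComm a b * lcsComm a' b := by
  rw [← QuotientGroup.mk_mul, lcsQuot_mk_eq_iff]
  have h := commutator_top_le_lcs G (k + l) (Subgroup.commutator_mem_commutator
    (inv_mem (lcsComm a b).2) (Subgroup.mem_top (a' : G)⁻¹))
  have h' := (lcs_normal G (k + l + 1)).conj_mem _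
    (inv_mem h) (gcomm (a' : G) b)⁻¹
  convert h' using 1
  simp [lcsComm, gcomm, commutatorElement_def, mul_assoc]

theorem lcsComm_mul_right {k l : ℕ} (a : lcs G k) (b b' : lcs G l) :
    (lcsComm a (b * b') : LcsQuot G (k + l)) = lcsComm a b * lcsComm a b' := by
  rw [mul_comm (lcsComm a b : LcsQuot G (k + l)), ← QuotientGroup.mk_mul, lcsQuot_mk_eq_iff]
  have h := commutator_top_le_lcs G (k + l) (Subgroup.commutator_mem_commutator
    (inv_mem (lcsComm a b).2) (Subgroup.mem_top (b' : G)⁻¹))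
  convert inv_mem h using 1
  simp [lcsComm, gcomm, commutatorElement_def, mul_assoc]

theorem lcsComm_eq_one_left {k l : ℕ} (a : lcs G k) (b : lcs G l)
    (ha : a ∈ (lcs G (k + 1)).subgroupOf (lcs G k)) :
    (lcsComm a b : LcsQuot G (k + l)) = 1 := by
  rw [QuotientGroup.eq_one_iff, Subgroup.mem_subgroupOf]
  exact lcs_antitone G (by omega) (gcomm_mem_lcs (Subgroup.mem_subgroupOf.1 ha) b.2)

theorem lcsComm_eq_one_right {k l : ℕ} (a : lcs G k) (b : lcs G l)
    (hb : b ∈ (lcs G (l + 1)).subgroupOf (lcs G l)) :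
    (lcsComm a b : LcsQuot G (k + l)) = 1 := by
  rw [QuotientGroup.eq_one_iff, Subgroup.mem_subgroupOf]
  exact lcs_antitone G (by omega) (gcomm_mem_lcs a.2 (Subgroup.mem_subgroupOf.1 hb))

/-- The map `γₖ/γₖ₊₁ × γₗ/γₗ₊₁ → γₖ₊ₗ/γₖ₊ₗ₊₁` induced by the commutator. -/
def lcsQuotComm (k l : ℕ) : LcsQuot G k →* LcsQuot G l →* LcsQuot G (k + l) :=
  QuotientGroup.lift _
    (MonoidHom.mk'
      (fun a => QuotientGroup.lift _
        (MonoidHom.mk' (fun b => (lcsComm a b : LcsQuot G (k + l))) (lcsComm_mul_right a))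
        (fun b hb => lcsComm_eq_one_right a b hb))
      (fun a a' => by
        ext b
        exact lcsComm_mul_left a a' b))
    (fun a ha => by
      ext b
      exact lcsComm_eq_one_left a b ha)

variable (G) in
/-- The graded component `Lᵏ(G) = γₖ(G) / γₖ₊₁(G)` of the associated Lie ring, written
additively. -/
def LieComp (k : ℕ) : Type _ := Additive (LcsQuot G k)

instance LieComp.instAddCommGroup (k : ℕ) : AddCommGroup (LieComp G k) :=
  inferInstanceAs (AddCommGroup (Additive (LcsQuot G k)))

/-- The class `ā ∈ Lᵏ(G)` of an element `a ∈ γₖ(G)`. -/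
def LieComp.cls {k : ℕ} (a : lcs G k) : LieComp G k :=
  Additive.ofMul (a : LcsQuot G k)

/-- The Lie bracket `Lᵏ(G) × Lˡ(G) → Lᵏ⁺ˡ(G)`, determined by `[ā, b̄] = class of (a, b)`;
it is biadditive. -/
def LieComp.bracket {k l : ℕ} : LieComp G k →+ LieComp G l →+ LieComp G (k + l) :=
  AddMonoidHom.mk' (fun x => MonoidHom.toAdditive (lcsQuotComm k l (Additive.toMul x)))
    (fun x y => congrArg MonoidHom.toAdditive
      (map_mul (lcsQuotComm k l) (Additive.toMul x) (Additive.toMul y)))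

theorem LieComp.bracket_cls {k l : ℕ} (a : lcs G k) (b : lcs G l) :
    LieComp.bracket (LieComp.cls a) (LieComp.cls b) = LieComp.cls (lcsComm a b) := rfl

theorem LieComp.cls_mul {k : ℕ} (a b : lcs G k) :
    LieComp.cls (a * b) = LieComp.cls a + LieComp.cls b := rfl

theorem LieComp.cls_surjective {k : ℕ} (x : LieComp G k) : ∃ a : lcs G k, LieComp.cls a = x :=
  QuotientGroup.mk_surjective (Additive.toMul x)

end Graded

/-! ### The case of a right-angled Coxeter group: vector spaces over the field of two elements -/

section

variable {m : ℕ} (K : AbstractSimplicialComplex (Fin m))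

/-- The class `ḡᵢ ∈ L¹` of the generator `gᵢ`. -/
def RACG.genClass (i : Fin m) : LieComp (RACG K) 1 :=
  LieComp.cls ⟨RACG.gen K i, Subgroup.mem_top _⟩

theorem RACG.sq_mem_lcs_two (a : RACG K) : a * a ∈ lcs (RACG K) 2 := by
  have ha : a ∈ Subgroup.closure (Set.range (RACG.gen K)) := by
    rw [RACG.closure_gen]; trivial
  rw [← QuotientGroup.eq_one_iff, QuotientGroup.mk_mul]
  have hc : ∀ x y : RACG K, (x : RACG K ⧸ lcs (RACG K) 2) * y = y * x := by
    intro x y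
    rw [← QuotientGroup.mk_mul, ← QuotientGroup.mk_mul, QuotientGroup.eq]
    have h : ⁅y⁻¹, x⁻¹⁆ ∈ lcs (RACG K) 2 :=
      Subgroup.commutator_mem_commutator (Subgroup.mem_top _) (Subgroup.mem_top _)
    convert h using 1
    simp [commutatorElement_def, mul_assoc]
  induction ha using Subgroup.closure_induction with
  | mem x hx =>
    obtain ⟨i, rfl⟩ := hx
    rw [← QuotientGroup.mk_mul, RACG.gen_sq]; rfl
  | one => exact mul_one _
  | mul x y _ _ hx hy =>
    rw [QuotientGroup.mk_mul, mul_assoc, ← mul_assoc _ (x : RACG K ⧸ lcs (RACG K) 2), hc y x,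
      mul_assoc, hy, mul_one, hx]
  | inv x _ hx =>
    rw [QuotientGroup.mk_inv, ← mul_inv_rev, hx, inv_one]

theorem RACG.sq_mem_lcs_succ (k : ℕ) (a : RACG K) (ha : a ∈ lcs (RACG K) k) :
    a * a ∈ lcs (RACG K) (k + 1) := by
  cases k with
  | zero => trivial
  | succ k =>
    induction k generalizing a with
    | zero => exact RACG.sq_mem_lcs_two K a
    | succ k ih =>
      rw [lcs_succ_succ] at ha
      have hc : ∀ x ∈ lcs (RACG K) (k + 2), ∀ y : RACG K,
          (x : RACG K ⧸ lcs (RACG K) (k + 3)) * y = y * x := by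
        intro x hx y
        rw [← QuotientGroup.mk_mul, ← QuotientGroup.mk_mul, eq_comm, QuotientGroup.eq]
        have h : ⁅x⁻¹, y⁻¹⁆ ∈ lcs (RACG K) (k + 3) :=
          Subgroup.commutator_mem_commutator (inv_mem hx) (Subgroup.mem_top _)
        convert h using 1
        simp [commutatorElement_def, mul_assoc]
      change a * a ∈ lcs (RACG K) (k + 3)
      rw [← QuotientGroup.eq_one_iff, QuotientGroup.mk_mul]
      refine (?_ : a ∈ lcs (RACG K) (k + 2) ∧ (a : RACG K ⧸ lcs (RACG K) (k + 3)) * a = 1).2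
      induction ha using Subgroup.closure_induction with
      | mem x hx =>
        obtain ⟨p, hp, q, -, rfl⟩ := hx
        have hpq : ⁅p, q⁆ ∈ lcs (RACG K) (k + 2) :=
          Subgroup.commutator_mem_commutator hp (Subgroup.mem_top _)
        refine ⟨hpq, ?_⟩
        have h1 : ⁅p * p, q⁆ ∈ lcs (RACG K) (k + 3) :=
          Subgroup.commutator_mem_commutator (ih p hp) (Subgroup.mem_top _)
        rw [commutatorElement_mul_left_eq_conj_mul, ← QuotientGroup.eq_one_iff] at h1
        simp only [QuotientGroup.mk_mul] at h1
        rw [← hc _ hpq p, mul_assoc (_ : RACG K ⧸ lcs (RACG K) (k + 3)) (p : RACG K ⧸ _),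
          ← QuotientGroup.mk_mul, mul_inv_cancel, QuotientGroup.mk_one, mul_one] at h1
        exact h1
      | one => exact ⟨one_mem _, mul_one _⟩
      | mul x y _ _ hx hy =>
        refine ⟨mul_mem hx.1 hy.1, ?_⟩
        rw [QuotientGroup.mk_mul, mul_assoc,
          ← mul_assoc _ (x : RACG K ⧸ lcs (RACG K) (k + 3)), hc y hy.1 x,
          mul_assoc, hy.2, mul_one, hx.2]
      | inv x _ hx =>
        refine ⟨inv_mem hx.1, ?_⟩
        rw [QuotientGroup.mk_inv, ← mul_inv_rev, hx.2, inv_one]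

theorem RACG.two_nsmul_lieComp (k : ℕ) (x : LieComp (RACG K) k) : 2 • x = 0 := by
  obtain ⟨a, rfl⟩ := LieComp.cls_surjective x
  rw [two_nsmul, ← LieComp.cls_mul]
  exact (QuotientGroup.eq_one_iff (a * a)).2
    (Subgroup.mem_subgroupOf.2 (RACG.sq_mem_lcs_succ K k a a.2))

/-- The only structure of a vector space over `ZMod 2` on the abelian group `Lᵏ`. -/
instance RACG.lieCompModule (k : ℕ) : Module (ZMod 2) (LieComp (RACG K) k) :=
  AddCommGroup.zmodModule (RACG.two_nsmul_lieComp K k)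

/-- `[ḡᵢ, ḡⱼ] ∈ L²`. -/
def RACG.lie₂ (i j : Fin m) : LieComp (RACG K) 2 :=
  LieComp.bracket (RACG.genClass K i) (RACG.genClass K j)

/-- The left-nested bracket `[ḡᵢ, ḡⱼ, ḡₖ] = [[ḡᵢ, ḡⱼ], ḡₖ] ∈ L³`. -/
def RACG.lie₃ (i j k : Fin m) : LieComp (RACG K) 3 :=
  LieComp.bracket (RACG.lie₂ K i j) (RACG.genClass K k)

end

/-! The proof pairs a spanning argument with an explicit dual family of functionals.

*Spanning.* Since `γₖ₊₁ = (γₖ, G)` and the bracket is biadditive, `Lᵏ` is spanned by the left-nested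
brackets of the `ḡᵢ`. As the generators are involutions, three relations cut these down to the
stated families: `[ḡᵢ, ḡⱼ] = [ḡⱼ, ḡᵢ]`; `[ḡᵢ, ḡⱼ, ḡᵢ] = [ḡᵢ, ḡⱼ, ḡⱼ]`, because both `gᵢ` and `gⱼ`
invert `(gᵢ, gⱼ) = (gᵢ gⱼ)²` (`RACG.lie₃_left_eq`); and the Jacobi identity, which is the Hall–Witt
identity read modulo `γ₄` (`RACG.lie₃_jacobi`).

*Independence.* A homomorphism from the group to a group `H` of class at most `3`, followed by a
function on `H` that is additive on `γₖ(H)` and vanishes on `γₖ₊₁(H)`, gives a functional on `Lᵏ`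
(`LieComp.functional`). Two choices of `H` suffice when no two generators commute.

* The unitriangular `4 × 4` matrices over `ZMod 2`, with `gₐ, g_b, g_c ↦ 1 + E₁₂, 1 + E₂₃, 1 + E₃₄`
  for distinct `a, b, c` and all other generators sent to `1`. The upper right entry then reads off
  the coefficient of the word `abc` in the Magnus expansion `gᵢ ↦ 1 + xᵢ`, `xᵢ² = 0`. Among the
  elements of the basis only `[ḡᵢ, ḡⱼ, ḡₖ]` involves the word `jik` beginning with its largest
  letter. Shorter words handle `L¹` and `L²` in the same way.
* The dihedral group of order `16`, with `gᵢ, gⱼ` sent to two adjacent reflections and all other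
  generators to `1`. It is needed because the mod `2` Magnus expansion kills `[ḡᵢ, ḡⱼ, ḡⱼ]`.

The functionals obtained in this way are exactly dual to the spanning families.
-/

/-! ### Functionals on the graded components -/

section Functional

variable {G H : Type*} [Group G] [Group H]

theorem map_mem_lcs (f : G →* H) (k : ℕ) {a : G} (ha : a ∈ lcs G k) : f a ∈ lcs H k := by
  have key : ∀ k, (lcs G (k + 1)).map f ≤ lcs H (k + 1) := by
    intro k
    induction k with
    | zero => exact le_top
    | succ k ih =>
      rw [lcs_succ_succ, lcs_succ_succ, Subgroup.map_commutator]
      exact Subgroup.commutator_mono ih le_top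
  cases k with
  | zero => trivial
  | succ k => exact key k (Subgroup.mem_map_of_mem f ha)

/-- The functional on `Lᵏ(G)` obtained by following a homomorphism `f : G → H` with a function `c`
on `H` that is additive on `γₖ(H)` and vanishes on `γₖ₊₁(H)`. -/
def LieComp.functional {A : Type*} [AddCommGroup A] (k : ℕ) (f : G →* H) (c : H → A)
    (hmul : ∀ a ∈ lcs H k, ∀ b ∈ lcs H k, c (a * b) = c a + c b)
    (hone : ∀ a ∈ lcs H (k + 1), c a = 0) : LieComp G k →+ A :=
  MonoidHom.toAdditiveLeft (QuotientGroup.lift ((lcs G (k + 1)).subgroupOf (lcs G k))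
    (MonoidHom.mk' (fun a : lcs G k => Multiplicative.ofAdd (c (f a)))
      (fun a b => by
        rw [← ofAdd_add, ← hmul _ (map_mem_lcs f k a.2) _ (map_mem_lcs f k b.2), ← map_mul]
        rfl))
    (fun a ha => congrArg Multiplicative.ofAdd
      (hone _ (map_mem_lcs f (k + 1) (Subgroup.mem_subgroupOf.1 ha)))))

theorem LieComp.functional_cls {A : Type*} [AddCommGroup A] (k : ℕ) (f : G →* H) (c : H → A)
    (hmul : ∀ a ∈ lcs H k, ∀ b ∈ lcs H k, c (a * b) = c a + c b)
    (hone : ∀ a ∈ lcs H (k + 1), c a = 0) (a : lcs G k) :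
    LieComp.functional k f c hmul hone (LieComp.cls a) = c (f a) := rfl

theorem map_gcomm (f : G →* H) (a b : G) : f (gcomm a b) = gcomm (f a) (f b) := by
  simp [gcomm]

theorem one_gcomm (a : G) : gcomm 1 a = 1 := by simp [gcomm]

theorem gcomm_one (a : G) : gcomm a 1 = 1 := by simp [gcomm]

end Functional

theorem exists_basis_of_dual {ι F V : Type*} [DecidableEq ι] [Fintype ι] [Field F]
    [AddCommGroup V] [Module F V] (v : ι → V) (φ : ι → V →ₗ[F] F)
    (hφ : ∀ a c, φ a (v c) = if c = a then 1 else 0)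
    (hv : ∀ x, x ∈ Submodule.span F (Set.range v)) :
    ∃ b : Module.Basis ι F V, ∀ i, b i = v i := by
  have hli : LinearIndependent F v := by
    refine LinearIndependent.of_comp (LinearMap.pi φ) ?_
    have h : (LinearMap.pi φ) ∘ v = fun i => Pi.single i (1 : F) := by
      funext c a
      simp [hφ, Pi.single_apply, eq_comm]
    rw [h]
    exact Pi.linearIndependent_single_one ι F
  exact ⟨Module.Basis.mk hli (fun x _ => hv x), fun i => by simp⟩

/-! ### Brackets generate the graded components -/

section Generation

variable {G : Type*} [Group G]

theorem LieComp.cls_eq_zero_iff {k : ℕ} (a : lcs G k) :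
    LieComp.cls a = 0 ↔ (a : G) ∈ lcs G (k + 1) :=
  (QuotientGroup.eq_one_iff a).trans Subgroup.mem_subgroupOf

theorem LieComp.cls_eq_cls_iff {k : ℕ} (a b : lcs G k) :
    LieComp.cls a = LieComp.cls b ↔ (a : G)⁻¹ * b ∈ lcs G (k + 1) :=
  lcsQuot_mk_eq_iff a b

theorem LieComp.cls_conj {k : ℕ} (a : lcs G k) (b : G) (h : b⁻¹ * a * b ∈ lcs G k) :
    LieComp.cls (⟨b⁻¹ * a * b, h⟩ : lcs G k) = LieComp.cls a := by
  rw [eq_comm, LieComp.cls_eq_cls_iff]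
  have := commutator_top_le_lcs G k
    (Subgroup.commutator_mem_commutator (inv_mem a.2) (Subgroup.mem_top b⁻¹))
  simpa [commutatorElement_def, mul_assoc] using this

theorem LieComp.closure_bracket {k : ℕ} (hk : k ≠ 0) {S : Set (LieComp G k)}
    {T : Set (LieComp G 1)} (hS : AddSubgroup.closure S = ⊤) (hT : AddSubgroup.closure T = ⊤) :
    AddSubgroup.closure (Set.image2 (fun x y => LieComp.bracket x y) S T)
      = (⊤ : AddSubgroup (LieComp G (k + 1))) := by
  set C := AddSubgroup.closure (Set.image2 (fun x y => LieComp.bracket x y) S T)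
  have hbr : ∀ (x : LieComp G k) (y : LieComp G 1), LieComp.bracket x y ∈ C := by
    intro x y
    have hx : x ∈ AddSubgroup.closure S := by rw [hS]; trivial
    have hy : y ∈ AddSubgroup.closure T := by rw [hT]; trivial
    induction hx using AddSubgroup.closure_induction with
    | mem x hx =>
      induction hy using AddSubgroup.closure_induction with
      | mem y hy => exact AddSubgroup.subset_closure ⟨x, hx, y, hy, rfl⟩
      | zero => rw [map_zero]; exact zero_mem _
      | add y z _ _ h1 h2 => rw [map_add]; exact add_mem h1 h2
      | neg y _ h => rw [map_neg]; exact neg_mem h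
    | zero => rw [map_zero]; exact zero_mem _
    | add x z _ _ h1 h2 => rw [map_add]; exact add_mem h1 h2
    | neg x _ h => rw [map_neg]; exact neg_mem h
  obtain ⟨k, rfl⟩ := Nat.exists_eq_succ_of_ne_zero hk
  have key : ∀ a (ha : a ∈ lcs G (k + 1 + 1)),
      LieComp.cls (⟨a, ha⟩ : lcs G (k + 1 + 1)) ∈ C := by
    intro a ha
    have ha' : a ∈ ⁅lcs G (k + 1), (⊤ : Subgroup G)⁆ := ha
    induction ha' using Subgroup.closure_induction with
    | mem x hx =>
      obtain ⟨p, hp, q, -, rfl⟩ := hx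
      have := hbr (LieComp.cls ⟨p⁻¹, inv_mem hp⟩) (LieComp.cls ⟨q⁻¹, Subgroup.mem_top _⟩)
      rw [LieComp.bracket_cls] at this
      convert this using 3
      simp [lcsComm, gcomm_eq]
    | one => exact zero_mem C
    | mul x y hx hy h1 h2 => exact add_mem (h1 hx) (h2 hy)
    | inv x hx h => exact neg_mem (h hx)
  rw [eq_top_iff]
  intro x _
  obtain ⟨a, rfl⟩ := LieComp.cls_surjective x
  exact key a.1 a.2

end Generation

/-! ### Spanning families in low degrees -/

section Spanning

variable {m : ℕ} (K : AbstractSimplicialComplex (Fin m))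

theorem RACG.closure_genClass : AddSubgroup.closure (Set.range (RACG.genClass K)) = ⊤ := by
  have key : ∀ a : RACG K, LieComp.cls (⟨a, Subgroup.mem_top a⟩ : lcs (RACG K) 1) ∈
      AddSubgroup.closure (Set.range (RACG.genClass K)) := by
    intro a
    have ha : a ∈ Subgroup.closure (Set.range (RACG.gen K)) := by
      rw [RACG.closure_gen]; trivial
    induction ha using Subgroup.closure_induction with
    | mem x hx =>
      obtain ⟨i, rfl⟩ := hx
      exact AddSubgroup.subset_closure ⟨i, rfl⟩
    | one => exact zero_mem (AddSubgroup.closure (Set.range (RACG.genClass K)))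
    | mul x y _ _ h1 h2 => exact add_mem h1 h2
    | inv x _ h => exact neg_mem h
  rw [eq_top_iff]
  intro x _
  obtain ⟨a, rfl⟩ := LieComp.cls_surjective x
  exact key a.1

theorem RACG.closure_lie₂ :
    AddSubgroup.closure (Set.range fun p : Fin m × Fin m => RACG.lie₂ K p.1 p.2) = ⊤ := by
  have h := LieComp.closure_bracket one_ne_zero (RACG.closure_genClass K)
    (RACG.closure_genClass K)
  rw [Set.image2_range] at h
  exact h

theorem RACG.gen_inv (i : Fin m) : (RACG.gen K i)⁻¹ = RACG.gen K i :=
  inv_eq_of_mul_eq_one_left (RACG.gen_sq K i)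

theorem RACG.add_self_lieComp {k : ℕ} (x : LieComp (RACG K) k) : x + x = 0 := by
  rw [← two_nsmul, RACG.two_nsmul_lieComp]

theorem RACG.neg_lieComp {k : ℕ} (x : LieComp (RACG K) k) : -x = x :=
  neg_eq_of_add_eq_zero_left (RACG.add_self_lieComp K x)

theorem RACG.lie₂_self (i : Fin m) : RACG.lie₂ K i i = 0 := by
  refine (LieComp.cls_eq_zero_iff _).2 ?_
  have : gcomm (RACG.gen K i) (RACG.gen K i) = 1 := by simp [gcomm]
  change gcomm (RACG.gen K i) (RACG.gen K i) ∈ _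
  rw [this]
  exact one_mem _

theorem RACG.lie₂_comm (i j : Fin m) : RACG.lie₂ K i j = RACG.lie₂ K j i := by
  rw [← RACG.neg_lieComp K (RACG.lie₂ K j i)]
  refine congrArg LieComp.cls (Subtype.ext ?_)
  change gcomm (RACG.gen K i) (RACG.gen K j) = (gcomm (RACG.gen K j) (RACG.gen K i))⁻¹
  simp [gcomm, mul_assoc]

theorem RACG.lie₃_comm (i j k : Fin m) : RACG.lie₃ K i j k = RACG.lie₃ K j i k := by
  rw [RACG.lie₃, RACG.lie₂_comm, RACG.lie₃]

/-- Both generators conjugate `(gᵢ, gⱼ) = (gᵢ gⱼ)²` to its inverse, so the two commutators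
coincide already in the group. -/
theorem RACG.lie₃_left_eq (i j : Fin m) : RACG.lie₃ K i j i = RACG.lie₃ K i j j := by
  refine congrArg LieComp.cls (Subtype.ext ?_)
  change gcomm (gcomm (RACG.gen K i) (RACG.gen K j)) (RACG.gen K i) =
    gcomm (gcomm (RACG.gen K i) (RACG.gen K j)) (RACG.gen K j)
  simp only [gcomm, mul_inv_rev, RACG.gen_inv, mul_assoc, RACG.gen_sq, mul_one]

/-- The Jacobi identity for generators: as these are involutions, the Hall–Witt identity says that
the product of conjugates of the three commutators is `1`. -/
theorem RACG.lie₃_jacobi (i j k : Fin m) :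
    RACG.lie₃ K i j k + RACG.lie₃ K j k i + RACG.lie₃ K k i j = 0 := by
  have hmem : ∀ a b c d : Fin m, (RACG.gen K d)⁻¹ *
      gcomm (gcomm (RACG.gen K a) (RACG.gen K b)) (RACG.gen K c) * RACG.gen K d ∈
        lcs (RACG K) 3 := fun a b c d => by
    have h : gcomm (gcomm (RACG.gen K a) (RACG.gen K b)) (RACG.gen K c) ∈ lcs (RACG K) 3 :=
      gcomm_mem_lcs (k := 2) (l := 1)
        (gcomm_mem_lcs (k := 1) (l := 1) (Subgroup.mem_top _) (Subgroup.mem_top _))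
        (Subgroup.mem_top _)
    simpa using (lcs_normal (RACG K) 3).conj_mem _ h (RACG.gen K d)⁻¹
  have hcls : ∀ a b c d : Fin m, RACG.lie₃ K a b c = LieComp.cls ⟨_, hmem a b c d⟩ :=
    fun a b c d => (LieComp.cls_conj (k := 3)
      (lcsComm (k := 2) (l := 1) (lcsComm (k := 1) (l := 1)
        ⟨RACG.gen K a, Subgroup.mem_top _⟩ ⟨RACG.gen K b, Subgroup.mem_top _⟩)
        ⟨RACG.gen K c, Subgroup.mem_top _⟩) (RACG.gen K d) (hmem a b c d)).symm
  rw [hcls i j k j, hcls j k i k, hcls k i j i, ← LieComp.cls_mul, ← LieComp.cls_mul]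
  refine (LieComp.cls_eq_zero_iff _).2 ?_
  convert one_mem (lcs (RACG K) 4)
  have hsq : ∀ (i : Fin m) x, RACG.gen K i * (RACG.gen K i * x) = x := fun i x => by
    rw [← mul_assoc, RACG.gen_sq, one_mul]
  simp only [Subgroup.coe_mul, gcomm, mul_inv_rev, RACG.gen_inv, mul_assoc, hsq, RACG.gen_sq]

theorem RACG.span_genClass (x : LieComp (RACG K) 1) :
    x ∈ Submodule.span (ZMod 2) (Set.range (RACG.genClass K)) := by
  have hx : x ∈ AddSubgroup.closure (Set.range (RACG.genClass K)) := by
    rw [RACG.closure_genClass]; trivial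
  exact AddSubgroup.closure_le (Submodule.span _ _).toAddSubgroup |>.2 Submodule.subset_span hx

theorem RACG.closure_lie₂_lt : AddSubgroup.closure
    (Set.range fun p : {p : Fin m × Fin m // p.1 < p.2} => RACG.lie₂ K p.1.1 p.1.2) = ⊤ := by
  rw [eq_top_iff, ← RACG.closure_lie₂, AddSubgroup.closure_le]
  rintro _ ⟨⟨i, j⟩, rfl⟩
  rcases lt_trichotomy i j with h | h | h
  · exact AddSubgroup.subset_closure ⟨⟨(i, j), h⟩, rfl⟩
  · subst h
    change RACG.lie₂ K i i ∈ _
    rw [RACG.lie₂_self]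
    exact zero_mem _
  · change RACG.lie₂ K i j ∈ _
    rw [RACG.lie₂_comm]
    exact AddSubgroup.subset_closure ⟨⟨(j, i), h⟩, rfl⟩

theorem RACG.span_lie₂ (x : LieComp (RACG K) 2) : x ∈ Submodule.span (ZMod 2)
    (Set.range fun p : {p : Fin m × Fin m // p.1 < p.2} => RACG.lie₂ K p.1.1 p.1.2) := by
  have hx : x ∈ AddSubgroup.closure
      (Set.range fun p : {p : Fin m × Fin m // p.1 < p.2} => RACG.lie₂ K p.1.1 p.1.2) := by
    rw [RACG.closure_lie₂_lt]; trivial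
  exact AddSubgroup.closure_le (Submodule.span _ _).toAddSubgroup |>.2 Submodule.subset_span hx

/-- The family of triple brackets `[ḡᵢ, ḡⱼ, ḡⱼ]` for `i < j` and `[ḡᵢ, ḡⱼ, ḡₖ]` for
`i, k < j`, `i ≠ k`. -/
def RACG.tripleFamily : ({p : Fin m × Fin m // p.1 < p.2} ⊕
    {t : Fin m × Fin m × Fin m // t.1 < t.2.1 ∧ t.2.2 < t.2.1 ∧ t.1 ≠ t.2.2}) →
      LieComp (RACG K) 3 :=
  Sum.elim (fun p => RACG.lie₃ K p.1.1 p.1.2 p.1.2)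
    (fun t => RACG.lie₃ K t.1.1 t.1.2.1 t.1.2.2)

theorem RACG.span_tripleFamily (x : LieComp (RACG K) 3) :
    x ∈ Submodule.span (ZMod 2) (Set.range (RACG.tripleFamily K)) := by
  have hx : x ∈ (⊤ : AddSubgroup (LieComp (RACG K) 3)) := trivial
  have hgen := LieComp.closure_bracket two_ne_zero (RACG.closure_lie₂_lt K)
    (RACG.closure_genClass K)
  rw [← hgen] at hx
  refine AddSubgroup.closure_le (Submodule.span _ _).toAddSubgroup |>.2 ?_ hx
  rintro _ ⟨_, ⟨⟨⟨i, j⟩, hij⟩, rfl⟩, _, ⟨k, rfl⟩, rfl⟩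
  change RACG.lie₃ K i j k ∈ Submodule.span (ZMod 2) (Set.range (RACG.tripleFamily K))
  have hij : i < j := hij
  have hpair : RACG.lie₃ K i j j ∈ Submodule.span (ZMod 2) (Set.range (RACG.tripleFamily K)) :=
    Submodule.subset_span ⟨Sum.inl ⟨(i, j), hij⟩, rfl⟩
  have htriple : ∀ a b c, a < b → c < b → a ≠ c →
      RACG.lie₃ K a b c ∈ Submodule.span (ZMod 2) (Set.range (RACG.tripleFamily K)) :=
    fun a b c h1 h2 h3 => Submodule.subset_span ⟨Sum.inr ⟨(a, b, c), h1, h2, h3⟩, rfl⟩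
  rcases lt_trichotomy k j with h | h | h
  · by_cases hik : i = k
    · subst hik
      rw [RACG.lie₃_left_eq]
      exact hpair
    · exact htriple i j k hij h hik
  · subst h
    exact hpair
  · have hjac := RACG.lie₃_jacobi K i j k
    rw [add_assoc, add_eq_zero_iff_eq_neg, RACG.neg_lieComp, RACG.lie₃_comm K k i] at hjac
    rw [hjac]
    exact add_mem (htriple j k i h (hij.trans h) hij.ne')
      (htriple i k j (hij.trans h) h hij.ne)

end Spanning

/-! ### Unitriangular matrices of size four -/

/-- The group of upper unitriangular `4 × 4` matrices over `R`, encoded by the entries above the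
diagonal. -/
@[ext]
structure Unitriangular (R : Type*) where
  e₁₂ : R
  e₂₃ : R
  e₃₄ : R
  e₁₃ : R
  e₂₄ : R
  e₁₄ : R

namespace Unitriangular

variable {R : Type*} [CommRing R]

instance : Mul (Unitriangular R) :=
  ⟨fun x y => ⟨x.e₁₂ + y.e₁₂, x.e₂₃ + y.e₂₃, x.e₃₄ + y.e₃₄,
    x.e₁₃ + x.e₁₂ * y.e₂₃ + y.e₁₃, x.e₂₄ + x.e₂₃ * y.e₃₄ + y.e₂₄,
    x.e₁₄ + x.e₁₃ * y.e₃₄ + x.e₁₂ * y.e₂₄ + y.e₁₄⟩⟩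

instance : One (Unitriangular R) := ⟨⟨0, 0, 0, 0, 0, 0⟩⟩

instance : Inv (Unitriangular R) :=
  ⟨fun x => ⟨-x.e₁₂, -x.e₂₃, -x.e₃₄, -x.e₁₃ + x.e₁₂ * x.e₂₃, -x.e₂₄ + x.e₂₃ * x.e₃₄,
    -x.e₁₄ + x.e₁₂ * x.e₂₄ + x.e₁₃ * x.e₃₄ - x.e₁₂ * x.e₂₃ * x.e₃₄⟩⟩

theorem mul_def (x y : Unitriangular R) :
    x * y = ⟨x.e₁₂ + y.e₁₂, x.e₂₃ + y.e₂₃, x.e₃₄ + y.e₃₄,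
      x.e₁₃ + x.e₁₂ * y.e₂₃ + y.e₁₃, x.e₂₄ + x.e₂₃ * y.e₃₄ + y.e₂₄,
      x.e₁₄ + x.e₁₃ * y.e₃₄ + x.e₁₂ * y.e₂₄ + y.e₁₄⟩ := rfl

theorem one_def : (1 : Unitriangular R) = ⟨0, 0, 0, 0, 0, 0⟩ := rfl

theorem inv_def (x : Unitriangular R) :
    x⁻¹ = ⟨-x.e₁₂, -x.e₂₃, -x.e₃₄, -x.e₁₃ + x.e₁₂ * x.e₂₃, -x.e₂₄ + x.e₂₃ * x.e₃₄,
      -x.e₁₄ + x.e₁₂ * x.e₂₄ + x.e₁₃ * x.e₃₄ - x.e₁₂ * x.e₂₃ * x.e₃₄⟩ := rfl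

instance : Group (Unitriangular R) :=
  Group.ofLeftAxioms
    (fun x y z => by ext <;> simp only [mul_def] <;> ring)
    (fun x => by ext <;> simp only [mul_def, one_def] <;> ring)
    (fun x => by ext <;> simp only [mul_def, one_def, inv_def] <;> ring)

variable (R) in
/-- The matrices with vanishing first superdiagonal. -/
def depthTwo : Subgroup (Unitriangular R) where
  carrier := {x | x.e₁₂ = 0 ∧ x.e₂₃ = 0 ∧ x.e₃₄ = 0}
  mul_mem' := by
    rintro x y ⟨h1, h2, h3⟩ ⟨h4, h5, h6⟩
    simp [mul_def, *]
  one_mem' := by simp [one_def]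
  inv_mem' := by
    rintro x ⟨h1, h2, h3⟩
    simp [inv_def, *]

variable (R) in
/-- The matrices with vanishing first and second superdiagonals. -/
def depthThree : Subgroup (Unitriangular R) where
  carrier := {x | (x.e₁₂ = 0 ∧ x.e₂₃ = 0 ∧ x.e₃₄ = 0) ∧ x.e₁₃ = 0 ∧ x.e₂₄ = 0}
  mul_mem' := by
    rintro x y ⟨⟨h1, h2, h3⟩, h7, h8⟩ ⟨⟨h4, h5, h6⟩, h9, h10⟩
    simp [mul_def, *]
  one_mem' := by simp [one_def]
  inv_mem' := by
    rintro x ⟨⟨h1, h2, h3⟩, h7, h8⟩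
    simp [inv_def, *]

theorem lcs_two_le : lcs (Unitriangular R) 2 ≤ depthTwo R := by
  refine Subgroup.commutator_le.2 fun x _ y _ => ⟨?_, ?_, ?_⟩ <;>
    simp only [commutatorElement_def, mul_def, inv_def] <;> ring

theorem lcs_three_le : lcs (Unitriangular R) 3 ≤ depthThree R := by
  rw [lcs_succ_succ]
  refine (Subgroup.commutator_mono lcs_two_le le_rfl).trans (Subgroup.commutator_le.2 ?_)
  rintro x ⟨h1, h2, h3⟩ y -
  refine ⟨⟨?_, ?_, ?_⟩, ?_, ?_⟩ <;>
    simp only [commutatorElement_def, mul_def, inv_def, h1, h2, h3] <;> ring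

theorem lcs_four_le : lcs (Unitriangular R) 4 ≤ ⊥ := by
  rw [lcs_succ_succ]
  refine (Subgroup.commutator_mono lcs_three_le le_rfl).trans (Subgroup.commutator_le.2 ?_)
  rintro x ⟨⟨h1, h2, h3⟩, h4, h5⟩ y -
  rw [Subgroup.mem_bot]
  ext <;> simp only [commutatorElement_def, mul_def, inv_def, one_def, h1, h2, h3, h4, h5] <;> ring

theorem gcomm_e₁₃ (x y : Unitriangular R) :
    (gcomm x y).e₁₃ = x.e₁₂ * y.e₂₃ - y.e₁₂ * x.e₂₃ := by
  simp only [gcomm, mul_def, inv_def]; ring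

/-- For matrices supported on the first superdiagonal the corner entry of a triple commutator is
that of the triple Lie bracket. -/
theorem gcomm_gcomm_e₁₄ (a b c a' b' c' a'' b'' c'' : R) :
    (gcomm (gcomm (⟨a, b, c, 0, 0, 0⟩ : Unitriangular R) ⟨a', b', c', 0, 0, 0⟩)
      ⟨a'', b'', c'', 0, 0, 0⟩).e₁₄ =
      a * b' * c'' - a' * b * c'' - a'' * b * c' + a'' * b' * c := by
  simp only [gcomm, mul_def, inv_def]; ring

end Unitriangular

/-! ### The dihedral group of order sixteen -/

namespace DihedralGroup

/-- The rotations by multiples of a quarter turn. -/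
def quarterTurns : Subgroup (DihedralGroup 8) where
  carrier := {x | x = 1 ∨ x = r 2 ∨ x = r 4 ∨ x = r 6}
  mul_mem' := by
    rintro x y (rfl | rfl | rfl | rfl) (rfl | rfl | rfl | rfl) <;> decide
  one_mem' := Or.inl rfl
  inv_mem' := by
    rintro x (rfl | rfl | rfl | rfl) <;> decide

/-- The identity and the half turn. -/
def halfTurns : Subgroup (DihedralGroup 8) where
  carrier := {x | x = 1 ∨ x = r 4}
  mul_mem' := by
    rintro x y (rfl | rfl) (rfl | rfl) <;> decide
  one_mem' := Or.inl rfl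
  inv_mem' := by
    rintro x (rfl | rfl) <;> decide

theorem lcs_two_le : lcs (DihedralGroup 8) 2 ≤ quarterTurns := by
  have h : ∀ x y : DihedralGroup 8, ⁅x, y⁆ = 1 ∨ ⁅x, y⁆ = r 2 ∨ ⁅x, y⁆ = r 4 ∨ ⁅x, y⁆ = r 6 := by
    decide
  exact Subgroup.commutator_le.2 fun x _ y _ => h x y

theorem lcs_three_le : lcs (DihedralGroup 8) 3 ≤ halfTurns := by
  rw [lcs_succ_succ]
  refine (Subgroup.commutator_mono lcs_two_le le_rfl).trans (Subgroup.commutator_le.2 ?_)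
  have h : ∀ x y : DihedralGroup 8, (x = 1 ∨ x = r 2 ∨ x = r 4 ∨ x = r 6) →
      ⁅x, y⁆ = 1 ∨ ⁅x, y⁆ = r 4 := by
    decide
  exact fun x hx y _ => h x y hx

theorem lcs_four_le : lcs (DihedralGroup 8) 4 ≤ ⊥ := by
  rw [lcs_succ_succ]
  refine (Subgroup.commutator_mono lcs_three_le le_rfl).trans (Subgroup.commutator_le.2 ?_)
  have h : ∀ x y : DihedralGroup 8, (x = 1 ∨ x = r 4) → ⁅x, y⁆ = 1 := by
    decide
  exact fun x hx y _ => Subgroup.mem_bot.2 (h x y hx)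

end DihedralGroup

/-! ### The free product of groups of order two -/

section FreeProduct

variable {m : ℕ} {K : AbstractSimplicialComplex (Fin m)}

/-- When the faces of `K` are points, any family of elements of square `1` defines a homomorphism. -/
def RACG.liftOfPoints (hK : ∀ s : Finset (Fin m), s ∈ K ↔ ∃ v, s = {v}) {H : Type*} [Group H]
    (u : Fin m → H) (hu : ∀ i, u i * u i = 1) : RACG K →* H :=
  PresentedGroup.toGroup (rels := racgRels K) (f := u) (by
    rintro r (⟨i, rfl⟩ | ⟨i, j, hij, rfl⟩)
    · rw [map_pow, FreeGroup.lift_apply_of, pow_two, hu]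
    · obtain ⟨v, hv⟩ := (hK _).1 hij
      have hi : i = v := Finset.mem_singleton.1 (hv ▸ Finset.mem_insert_self i {j})
      have hj : j = v := Finset.mem_singleton.1
        (hv ▸ Finset.mem_insert_of_mem (Finset.mem_singleton_self j))
      rw [hi, hj, mul_inv_cancel, map_one])

@[simp]
theorem RACG.liftOfPoints_gen (hK : ∀ s : Finset (Fin m), s ∈ K ↔ ∃ v, s = {v}) {H : Type*}
    [Group H] (u : Fin m → H) (hu : ∀ i, u i * u i = 1) (i : Fin m) :
    RACG.liftOfPoints hK u hu (RACG.gen K i) = u i :=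
  PresentedGroup.toGroup.of _

variable (K) in
theorem RACG.hom_ext {H : Type*} [Group H] {f g : RACG K →* H}
    (h : ∀ i, f (RACG.gen K i) = g (RACG.gen K i)) : f = g :=
  PresentedGroup.ext h

/-- The homomorphism from the group of order two determined by an element of square `1`. -/
def homOfMulSelf {H : Type*} [Group H] (x : H) (hx : x * x = 1) :
    Multiplicative (ZMod 2) →* H :=
  MonoidHom.mk' (fun a => x ^ a.toAdd.val) (by
    have h : ∀ a b : ZMod 2, x ^ (a + b).val = x ^ a.val * x ^ b.val := by
      intro a b
      rw [ZMod.val_add, ← pow_add, ← pow_mod_orderOf x (a.val + b.val),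
        ← pow_mod_orderOf x ((a.val + b.val) % 2),
        Nat.mod_mod_of_dvd _ (orderOf_dvd_of_pow_eq_one (by rw [pow_two, hx]))]
    exact fun a b => h a.toAdd b.toAdd)

theorem homOfMulSelf_ofAdd_one {H : Type*} [Group H] (x : H) (hx : x * x = 1) :
    homOfMulSelf x hx (Multiplicative.ofAdd 1) = x :=
  pow_one x

theorem RACG.exists_mulEquiv_coprodI (hK : ∀ s : Finset (Fin m), s ∈ K ↔ ∃ v, s = {v}) :
    ∃ e : RACG K ≃* Monoid.CoprodI (fun _ : Fin m => Multiplicative (ZMod 2)),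
      ∀ i, e (RACG.gen K i) =
        Monoid.CoprodI.of (i := i) (Multiplicative.ofAdd (1 : ZMod 2)) := by
  let u : Fin m → Monoid.CoprodI (fun _ : Fin m => Multiplicative (ZMod 2)) :=
    fun i => Monoid.CoprodI.of (i := i) (Multiplicative.ofAdd (1 : ZMod 2))
  have hu : ∀ i, u i * u i = 1 := fun i => by
    have h : Multiplicative.ofAdd (1 : ZMod 2) * Multiplicative.ofAdd (1 : ZMod 2) = 1 := by decide
    simp only [u, ← map_mul, h, map_one]
  let f := RACG.liftOfPoints hK u hu
  let g : Monoid.CoprodI (fun _ : Fin m => Multiplicative (ZMod 2)) →* RACG K :=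
    Monoid.CoprodI.lift fun i => homOfMulSelf (RACG.gen K i) (RACG.gen_sq K i)
  have hgu : ∀ i, g (u i) = RACG.gen K i := fun i => by
    simp only [g, u, Monoid.CoprodI.lift_of, homOfMulSelf_ofAdd_one]
  refine ⟨MonoidHom.toMulEquiv f g (RACG.hom_ext K fun i => ?_) ?_, fun i => ?_⟩
  · simp [f, hgu]
  · refine Monoid.CoprodI.ext_hom _ _ fun i => MonoidHom.ext fun a => ?_
    have ha : ∀ a : Multiplicative (ZMod 2), a = 1 ∨ a = Multiplicative.ofAdd 1 := by decide
    rcases ha a with rfl | rfl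
    · simp
    · change f (g (u i)) = u i
      rw [hgu, RACG.liftOfPoints_gen]
  · exact RACG.liftOfPoints_gen hK u hu i

/-! ### Dual functionals -/

/-- The homomorphism to the unitriangular matrices sending `gᵢ` to the matrix with superdiagonal
`(u i, v i, w i)` and zeros above it; the hypotheses make these images involutions. -/
def RACG.toUnitriangular (hK : ∀ s : Finset (Fin m), s ∈ K ↔ ∃ v, s = {v})
    (u v w : Fin m → ZMod 2) (huv : ∀ i, u i * v i = 0) (hvw : ∀ i, v i * w i = 0) :
    RACG K →* Unitriangular (ZMod 2) :=
  RACG.liftOfPoints hK (fun i => ⟨u i, v i, w i, 0, 0, 0⟩) fun i => by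
    simp [Unitriangular.mul_def, Unitriangular.one_def, huv, hvw, CharTwo.add_self_eq_zero]

/-- The coefficient of `gₐ` on `L¹`. -/
def RACG.dual₁ (hK : ∀ s : Finset (Fin m), s ∈ K ↔ ∃ v, s = {v}) (a : Fin m) :
    LieComp (RACG K) 1 →+ ZMod 2 :=
  LieComp.functional 1
    (RACG.toUnitriangular hK (Pi.single a 1) 0 0 (by simp) (by simp)) Unitriangular.e₁₂
    (fun _ _ _ _ => rfl) (fun _ hx => (Unitriangular.lcs_two_le hx).1)

theorem RACG.dual₁_genClass (hK : ∀ s : Finset (Fin m), s ∈ K ↔ ∃ v, s = {v}) (a i : Fin m) :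
    RACG.dual₁ hK a (RACG.genClass K i) = if i = a then 1 else 0 := by
  rw [RACG.dual₁, RACG.genClass, LieComp.functional_cls, RACG.toUnitriangular,
    RACG.liftOfPoints_gen]
  exact Pi.single_apply a 1 i

/-- The coefficient of the Magnus word `ab` on `L²`. -/
def RACG.dual₂ (hK : ∀ s : Finset (Fin m), s ∈ K ↔ ∃ v, s = {v}) (a b : Fin m) (hab : a ≠ b) :
    LieComp (RACG K) 2 →+ ZMod 2 :=
  LieComp.functional 2
    (RACG.toUnitriangular hK (Pi.single a 1) (Pi.single b 1) 0
      (fun i => by simp only [Pi.single_apply]; grind) (by simp)) Unitriangular.e₁₃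
    (fun x hx y _ => by
      simp [Unitriangular.mul_def, (Unitriangular.lcs_two_le hx).1])
    (fun _ hx => (Unitriangular.lcs_three_le hx).2.1)

theorem RACG.dual₂_lie₂ (hK : ∀ s : Finset (Fin m), s ∈ K ↔ ∃ v, s = {v}) (a b : Fin m)
    (hab : a ≠ b) (i j : Fin m) : RACG.dual₂ hK a b hab (RACG.lie₂ K i j) =
      (if i = a then 1 else 0) * (if j = b then 1 else 0) -
        (if j = a then 1 else 0) * (if i = b then 1 else 0) := by
  rw [RACG.dual₂, RACG.lie₂, RACG.genClass, RACG.genClass, LieComp.bracket_cls,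
    LieComp.functional_cls, lcsComm, map_gcomm, Unitriangular.gcomm_e₁₃, RACG.toUnitriangular,
    RACG.liftOfPoints_gen, RACG.liftOfPoints_gen]
  simp only [Pi.single_apply]

/-- The coefficient of the Magnus word `abc` on `L³`. -/
def RACG.dual₃ (hK : ∀ s : Finset (Fin m), s ∈ K ↔ ∃ v, s = {v}) (a b c : Fin m) (hab : a ≠ b)
    (hbc : b ≠ c) : LieComp (RACG K) 3 →+ ZMod 2 :=
  LieComp.functional 3
    (RACG.toUnitriangular hK (Pi.single a 1) (Pi.single b 1) (Pi.single c 1)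
      (fun i => by simp only [Pi.single_apply]; grind)
      (fun i => by simp only [Pi.single_apply]; grind)) Unitriangular.e₁₄
    (fun x hx y hy => by
      obtain ⟨⟨h1, -, -⟩, h2, -⟩ := Unitriangular.lcs_three_le hx
      simp [Unitriangular.mul_def, h1, h2])
    (fun x hx => by
      rw [Subgroup.mem_bot.1 (Unitriangular.lcs_four_le hx)]; rfl)

theorem RACG.dual₃_lie₃ (hK : ∀ s : Finset (Fin m), s ∈ K ↔ ∃ v, s = {v}) (a b c : Fin m)
    (hab : a ≠ b) (hbc : b ≠ c) (i j k : Fin m) :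
    RACG.dual₃ hK a b c hab hbc (RACG.lie₃ K i j k) =
      (if i = a then 1 else 0) * (if j = b then 1 else 0) * (if k = c then 1 else 0) -
      (if j = a then 1 else 0) * (if i = b then 1 else 0) * (if k = c then 1 else 0) -
      (if k = a then 1 else 0) * (if i = b then 1 else 0) * (if j = c then 1 else 0) +
      (if k = a then 1 else 0) * (if j = b then 1 else 0) * (if i = c then 1 else 0) := by
  rw [RACG.dual₃, RACG.lie₃, RACG.lie₂, RACG.genClass, RACG.genClass, RACG.genClass,
    LieComp.bracket_cls, LieComp.bracket_cls, LieComp.functional_cls, lcsComm, lcsComm, map_gcomm,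
    map_gcomm, RACG.toUnitriangular, RACG.liftOfPoints_gen, RACG.liftOfPoints_gen,
    RACG.liftOfPoints_gen, Unitriangular.gcomm_gcomm_e₁₄]
  simp only [Pi.single_apply]

/-- The images of the generators under the homomorphism to the dihedral group of order `16`. -/
def dihedralGen (a b i : Fin m) : DihedralGroup 8 :=
  if i = a then .sr 0 else if i = b then .sr 1 else 1

/-- The functional on `L³` detecting `[gₐ, g_b, g_b]` in the dihedral group of order `16`. -/
def RACG.dualDihedral (hK : ∀ s : Finset (Fin m), s ∈ K ↔ ∃ v, s = {v}) (a b : Fin m) :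
    LieComp (RACG K) 3 →+ ZMod 2 :=
  LieComp.functional 3
    (RACG.liftOfPoints hK (dihedralGen a b) fun i => by
      unfold dihedralGen; split_ifs <;> decide)
    (fun x => if x = .r 4 then 1 else 0)
    (fun x hx y hy => by
      rcases DihedralGroup.lcs_three_le hx with rfl | rfl <;>
        rcases DihedralGroup.lcs_three_le hy with rfl | rfl <;> decide)
    (fun x hx => by
      rw [Subgroup.mem_bot.1 (DihedralGroup.lcs_four_le hx)]; decide)

theorem RACG.dualDihedral_lie₃ (hK : ∀ s : Finset (Fin m), s ∈ K ↔ ∃ v, s = {v})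
    (a b i j k : Fin m) : RACG.dualDihedral hK a b (RACG.lie₃ K i j k) =
      if gcomm (gcomm (dihedralGen a b i) (dihedralGen a b j)) (dihedralGen a b k) = .r 4
        then 1 else 0 := by
  rw [RACG.dualDihedral, RACG.lie₃, RACG.lie₂, RACG.genClass, RACG.genClass, RACG.genClass,
    LieComp.bracket_cls, LieComp.bracket_cls, LieComp.functional_cls, lcsComm, lcsComm, map_gcomm,
    map_gcomm, RACG.liftOfPoints_gen, RACG.liftOfPoints_gen, RACG.liftOfPoints_gen]

theorem gcomm_dihedralGen_pair {a b i j : Fin m} (hab : a < b) (hij : i < j) :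
    gcomm (gcomm (dihedralGen a b i) (dihedralGen a b j)) (dihedralGen a b j) = .r 4 ↔
      i = a ∧ j = b := by
  constructor
  · intro h
    by_contra hne
    have h1 : dihedralGen a b i = 1 ∨ dihedralGen a b j = 1 := by
      unfold dihedralGen; grind
    rcases h1 with h1 | h1 <;> rw [h1] at h <;> simp only [one_gcomm, gcomm_one] at h <;>
      exact absurd h (by decide)
  · rintro ⟨rfl, rfl⟩
    rw [dihedralGen, dihedralGen, if_pos rfl, if_neg hab.ne', if_pos rfl]
    decide

theorem gcomm_dihedralGen_triple {a b i j k : Fin m} (hij : i ≠ j) (hjk : j ≠ k) (hik : i ≠ k) :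
    gcomm (gcomm (dihedralGen a b i) (dihedralGen a b j)) (dihedralGen a b k) ≠ .r 4 := by
  -- One of three distinct generators is sent to `1`.
  have h : dihedralGen a b i = 1 ∨ dihedralGen a b j = 1 ∨ dihedralGen a b k = 1 := by
    unfold dihedralGen; grind
  rcases h with h | h | h <;> rw [h] <;> simp only [one_gcomm, gcomm_one] <;> decide

/-- The functionals dual to `RACG.tripleFamily`. The bracket of a triple `(i, j, k)` is detected by
the word `jik`, which starts with the largest letter `j`. -/
def RACG.dualTriple (hK : ∀ s : Finset (Fin m), s ∈ K ↔ ∃ v, s = {v}) :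
    ({p : Fin m × Fin m // p.1 < p.2} ⊕
      {t : Fin m × Fin m × Fin m // t.1 < t.2.1 ∧ t.2.2 < t.2.1 ∧ t.1 ≠ t.2.2}) →
        LieComp (RACG K) 3 →+ ZMod 2 :=
  Sum.elim (fun p => RACG.dualDihedral hK p.1.1 p.1.2)
    (fun t => RACG.dual₃ hK t.1.2.1 t.1.1 t.1.2.2 t.2.1.ne' t.2.2.2)

theorem RACG.dualTriple_tripleFamily (hK : ∀ s : Finset (Fin m), s ∈ K ↔ ∃ v, s = {v})
    (a c : {p : Fin m × Fin m // p.1 < p.2} ⊕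
      {t : Fin m × Fin m × Fin m // t.1 < t.2.1 ∧ t.2.2 < t.2.1 ∧ t.1 ≠ t.2.2}) :
    RACG.dualTriple hK a (RACG.tripleFamily K c) = if c = a then 1 else 0 := by
  rcases a with ⟨⟨a, b⟩, hab⟩ | ⟨⟨a, b, c'⟩, hab, hcb, hac⟩ <;>
    rcases c with ⟨⟨i, j⟩, hij⟩ | ⟨⟨i, j, k⟩, hij, hkj, hik⟩
  · change RACG.dualDihedral hK a b (RACG.lie₃ K i j j) = _
    rw [RACG.dualDihedral_lie₃]
    simp only [gcomm_dihedralGen_pair hab hij, Sum.inl.injEq, Subtype.mk.injEq, Prod.mk.injEq]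
  · change RACG.dualDihedral hK a b (RACG.lie₃ K i j k) = _
    rw [RACG.dualDihedral_lie₃, if_neg (gcomm_dihedralGen_triple hij.ne hkj.ne' hik)]
    simp
  · change RACG.dual₃ hK b a c' hab.ne' hac (RACG.lie₃ K i j j) = _
    rw [RACG.dual₃_lie₃]
    simp only [reduceCtorEq, if_false]
    grind
  · change RACG.dual₃ hK b a c' hab.ne' hac (RACG.lie₃ K i j k) = _
    rw [RACG.dual₃_lie₃]
    simp only [Sum.inr.injEq, Subtype.mk.injEq, Prod.mk.injEq]
    dsimp only at *
    grind

end FreeProduct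

theorem corollary4p6 (m : ℕ) (K : AbstractSimplicialComplex (Fin m))
    (hK : ∀ s : Finset (Fin m), s ∈ K ↔ ∃ v, s = {v}) :
    (∃ e : RACG K ≃* Monoid.CoprodI (fun _ : Fin m => Multiplicative (ZMod 2)),
      ∀ i, e (RACG.gen K i) = Monoid.CoprodI.of (i := i) (Multiplicative.ofAdd (1 : ZMod 2))) ∧
    (∃ b : Module.Basis (Fin m) (ZMod 2) (LieComp (RACG K) 1),
      ∀ i, b i = RACG.genClass K i) ∧
    (∃ b : Module.Basis {p : Fin m × Fin m // p.1 < p.2} (ZMod 2) (LieComp (RACG K) 2),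
      ∀ p, b p = RACG.lie₂ K p.1.1 p.1.2) ∧
    (∃ b : Module.Basis ({p : Fin m × Fin m // p.1 < p.2} ⊕
          {t : Fin m × Fin m × Fin m // t.1 < t.2.1 ∧ t.2.2 < t.2.1 ∧ t.1 ≠ t.2.2})
        (ZMod 2) (LieComp (RACG K) 3),
      (∀ p, b (Sum.inl p) = RACG.lie₃ K p.1.1 p.1.2 p.1.2) ∧
      (∀ t, b (Sum.inr t) = RACG.lie₃ K t.1.1 t.1.2.1 t.1.2.2)) := by
  refine ⟨RACG.exists_mulEquiv_coprodI hK, ?_, ?_, ?_⟩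
  · exact exists_basis_of_dual _ (fun a => (RACG.dual₁ hK a).toZModLinearMap 2)
      (RACG.dual₁_genClass hK) (RACG.span_genClass K)
  · refine exists_basis_of_dual _
      (fun p => (RACG.dual₂ hK p.1.2 p.1.1 p.2.ne').toZModLinearMap 2) ?_ (RACG.span_lie₂ K)
    rintro ⟨⟨a, b⟩, hab⟩ ⟨⟨i, j⟩, hij⟩
    change RACG.dual₂ hK b a hab.ne' (RACG.lie₂ K i j) = _
    rw [RACG.dual₂_lie₂]
    simp only [Subtype.mk.injEq, Prod.mk.injEq]
    dsimp only at hab hij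
    -- The word `ba` has its larger letter first, so only `-x_j x_i` contributes, and `-1 = 1`.
    have h2 : (-1 : ZMod 2) = 1 := by decide
    grind
  · obtain ⟨b, hb⟩ := exists_basis_of_dual _
      (fun a => (RACG.dualTriple hK a).toZModLinearMap 2)
      (RACG.dualTriple_tripleFamily hK) (RACG.span_tripleFamily K)
    exact ⟨b, fun p => hb (Sum.inl p), fun t => hb (Sum.inr t)⟩
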